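/- For positive integers $d_1,d_2$ let $K(d_1,d_2)=(\mathbb{Z}/d_1\mathbb{Z}\times\mathbb{Z}/d_2\mathbb{Z})^2$ with standard generators $f_1,f_2,f_3,f_4$ ($f_i$ and $f_{i+2}$ of order $d_i$ for $i=1,2$), and let $e:K(d_1,d_2)\times K(d_1,d_2)\to\mathbb{C}^*$ be the standard symplectic form, that is, the bimultiplicative form with $e(f_i,f_{i+2})=\exp(2\pi i/d_i)$ and $e(f_{i+2},f_i)=\exp(-2\pi i/d_i)$ for $i=1,2$ (the $i$ next to $\pi$ being the imaginary unit), and $e(f_\mu,f_\nu)=1$ for all other pairs of generators. A subgroup $H$ is isotropic if $e(h,h')=1$ for all $h,h'\in H$, and maximal isotropic if it is maximal with respect to inclusion among the isotropic subgroups. Let $p$ be a prime and $n\ge 1$ an integer, and write $\mathbb{Z}_{p^m}:=\mathbb{Z}/p^m\mathbb{Z}$. For a finite abelian group $T$ let $\nu(T)$ denote the number of maximal isotropic subgroups of $K(p^n,p^n)$ that are isomorphic to $T$ as abstract groups. Then, for integers $k,l$: 1. (type $1$) $\nu(\mathbb{Z}_{p^n}^2)=p^{3n-3}(p^2+1)(p+1)$.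 2. (type $2_k$) If $0<k<n-k<n$, then $\nu(\mathbb{Z}_{p^n}\times\mathbb{Z}_{p^{n-k}}\times\mathbb{Z}_{p^k})=p^{3n-2k-4}(p^2+1)(p+1)^2$. 3. (type $3$) If $2k=n$, then $\nu(\mathbb{Z}_{p^n}\times\mathbb{Z}_{p^k}\times\mathbb{Z}_{p^k})=p^{2n-3}(p^2+1)(p+1)$. 4. (type $4_{k,l}$) If $0<l<k<n-k$, then $\nu(\mathbb{Z}_{p^{n-l}}\times\mathbb{Z}_{p^{n-k}}\times\mathbb{Z}_{p^k}\times\mathbb{Z}_{p^l})=p^{3n-4l-2k-4}(p^2+1)(p+1)^2$. 5. (type $5_l$) If $0<l<k<n$ and $2k=n$, then $\nu(\mathbb{Z}_{p^{n-l}}\times\mathbb{Z}_{p^k}\times\mathbb{Z}_{p^k}\times\mathbb{Z}_{p^l})=p^{2n-4l-3}(p^2+1)(p+1)$. 6. (type $6_k$) If $0<k<n-k<n$, then $\nu(\mathbb{Z}_{p^{n-k}}^2\times\mathbb{Z}_{p^k}^2)=p^{3n-6k-3}(p^2+1)(p+1)$. 7. (type $7$) If $2k=n$, then $\nu(\mathbb{Z}_{p^k}^4)=1$.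 -/

import Mathlib

/-- The group `K(d_1, …, d_g) = (ℤ/d_1 × ⋯ × ℤ/d_g)²`. Its standard generators are
`f_i = (e_i, 0)` and `f_{g+i} = (0, e_i)`. -/
abbrev SympK {g : ℕ} (d : Fin g → ℕ) : Type :=
  (∀ i, ZMod (d i)) × (∀ i, ZMod (d i))

/-- The standard symplectic form `e : K(d_1, …, d_g)² → ℂˣ`, written with values in `ℂ`: it is the
bimultiplicative form with `e(f_i, f_{g+i}) = exp(2πi/d_i)`, `e(f_{g+i}, f_i) = exp(-2πi/d_i)`
and `e = 1` on all other pairs of generators. Here `ZMod.stdAddChar` is the character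
`j ↦ exp(2πij/N)` of `ZMod N`. -/
noncomputable def sympForm {g : ℕ} (d : Fin g → ℕ) [∀ i, NeZero (d i)] (x y : SympK d) : ℂ :=
  ∏ i, ZMod.stdAddChar (x.1 i * y.2 i - x.2 i * y.1 i)

/-- (Totally) isotropic subgroups of `K(d_1, …, d_g)`. -/
def IsIsotropicSubgroup {g : ℕ} (d : Fin g → ℕ) [∀ i, NeZero (d i)]
    (H : AddSubgroup (SympK d)) : Prop :=
  ∀ x ∈ H, ∀ y ∈ H, sympForm d x y = 1

/-- Maximal isotropic subgroups: isotropic subgroups that are maximal under inclusion. -/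
def IsMaximalIsotropic {g : ℕ} (d : Fin g → ℕ) [∀ i, NeZero (d i)]
    (M : AddSubgroup (SympK d)) : Prop :=
  Maximal (IsIsotropicSubgroup d) M

/-- The number of maximal isotropic subgroups of `K(d_1, …, d_g)` that are isomorphic, as abstract
groups, to `T`. -/
noncomputable def numMaxIsotropic {g : ℕ} (d : Fin g → ℕ) [∀ i, NeZero (d i)]
    (T : Type) [AddCommGroup T] : ℕ :=
  Nat.card {M : AddSubgroup (SympK d) // IsMaximalIsotropic d M ∧ Nonempty (M ≃+ T)}

/-- The number `ν(p^n, p^n)(T)` of maximal isotropic subgroups of `K(p^n, p^n)` isomorphic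
to `T`. -/
noncomputable def nuType (p n : ℕ) [NeZero p] (T : Type) [AddCommGroup T] : ℕ :=
  numMaxIsotropic (fun _ : Fin 2 => p ^ n) T

/-! Write V = (ℤ/p^n)^{2g}. Maximal isotropic subgroups of V are the Lagrangian ones, H = H^⊥. A
finite abelian p-group is determined up to isomorphism by the sizes of its p^i-torsion subgroups, so
ν(T) becomes `lagrangianCount`: a count of Lagrangians with prescribed torsion sizes p^{s(i)}. Such
data can be followed through reductions without choosing decompositions. Two reductions suffice.

Peeling (`lagrangianCount_add_two`): if H contains V[p], then H = H^⊥ lies in V[p]^⊥ = pV. Dividing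
by p and reducing coefficients turns H into a Lagrangian over ℤ/p^{n-2}, since ⟨pz, pw⟩ = p²⟨z, w⟩.
Every cyclic factor loses one power of p.

Splitting (`lagrangianCount_succ_mul`): if H contains an element x of order p^n, count the pairs (H,
x). Transvections act transitively on elements of order p^n, and the Lagrangians through a basis
vector e are the Lagrangians of e^⊥/⟨e⟩, which has rank 2(g-1).

For g = 2, peel off the smallest invariant, split off the factor ℤ/p^n that then appears, and repeat
for g = 1. If the exponent drops to 0, there is exactly one Lagrangian. -/

/-! ### Torsion counts as invariants of finite abelian p-groups. -/

/-- The number of elements of an abelian group that are killed by `q`. -/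
noncomputable def torsionCard (q : ℕ) (A : Type*) [AddCommGroup A] : ℕ :=
  Nat.card {x : A // q • x = 0}

theorem torsionCard_congr (q : ℕ) {A B : Type*} [AddCommGroup A] [AddCommGroup B] (f : A ≃+ B) :
    torsionCard q A = torsionCard q B :=
  Nat.card_congr (f.toEquiv.subtypeEquiv fun x => by
    simp [← map_nsmul])

theorem torsionCard_prod (q : ℕ) (A B : Type*) [AddCommGroup A] [AddCommGroup B] :
    torsionCard q (A × B) = torsionCard q A * torsionCard q B := by
  unfold torsionCard
  rw [← Nat.card_prod]
  refine Nat.card_congr ((Equiv.subtypeEquivRight fun x => ?_).trans Equiv.subtypeProdEquivProd)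
  simp [Prod.ext_iff]

theorem torsionCard_pi (q : ℕ) {ι : Type*} [Fintype ι] (A : ι → Type*) [∀ i, AddCommGroup (A i)] :
    torsionCard q (∀ i, A i) = ∏ i, torsionCard q (A i) := by
  unfold torsionCard
  rw [← Nat.card_pi]
  refine Nat.card_congr ((Equiv.subtypeEquivRight fun x => ?_).trans Equiv.subtypePiEquivPi)
  simp [funext_iff]

theorem torsionCard_one (A : Type*) [AddCommGroup A] : torsionCard 1 A = 1 := by
  unfold torsionCard
  simp

theorem torsionCard_eq_card {q : ℕ} {A : Type*} [AddCommGroup A] (h : ∀ x : A, q • x = 0) :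
    torsionCard q A = Nat.card A :=
  Nat.card_congr (Equiv.subtypeUnivEquiv h)

/-- The restriction of `f` to the preimage of `S` is onto `S` and still has kernel `f.ker`. -/
theorem AddMonoidHom.card_comap_of_le_range {A B : Type*} [AddCommGroup A] [AddCommGroup B]
    (f : A →+ B) {S : AddSubgroup B} (hS : S ≤ f.range) :
    Nat.card (S.comap f) = Nat.card f.ker * Nat.card S := by
  let φ : S.comap f →+ S := (f.comp (S.comap f).subtype).codRestrict S fun x => x.2
  have hφ : Function.Surjective φ := by
    rintro ⟨y, hy⟩
    obtain ⟨x, rfl⟩ := hS hy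
    exact ⟨⟨x, hy⟩, rfl⟩
  rw [AddSubgroup.card_eq_card_quotient_mul_card_addSubgroup φ.ker, mul_comm,
    Nat.card_congr (QuotientAddGroup.quotientKerEquivOfSurjective φ hφ).toEquiv]
  congr 1
  refine Nat.card_congr ⟨fun x => ⟨x.1.1, ?_⟩, fun x => ⟨⟨x.1, ?_⟩, ?_⟩, fun _ => rfl, fun _ => rfl⟩
  · exact congrArg Subtype.val (AddMonoidHom.mem_ker.1 x.2)
  · have := x.2
    rw [AddMonoidHom.mem_ker] at this
    simp [this, S.zero_mem]
  · exact AddMonoidHom.mem_ker.2 (Subtype.ext (AddMonoidHom.mem_ker.1 x.2))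

theorem AddMonoidHom.card_ker_mul_card_range {A B : Type*} [AddCommGroup A] [AddCommGroup B]
    (f : A →+ B) : Nat.card f.ker * Nat.card f.range = Nat.card A := by
  rw [← f.card_comap_of_le_range le_rfl]
  refine Nat.card_congr (Equiv.subtypeUnivEquiv fun x => ?_)
  simp

/-- The image of multiplication by `q` is cyclic, generated by `q`, of order `N / gcd(N, q)`; the
kernel has the complementary size. -/
theorem torsionCard_zmod (N q : ℕ) [NeZero N] : torsionCard q (ZMod N) = N.gcd q := by
  have h := (nsmulAddMonoidHom (α := ZMod N) q).card_ker_mul_card_range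
  have hr : (nsmulAddMonoidHom (α := ZMod N) q).range = AddSubgroup.zmultiples (q : ZMod N) := by
    ext x
    simp only [AddMonoidHom.mem_range, nsmulAddMonoidHom_apply, AddSubgroup.mem_zmultiples_iff,
      nsmul_eq_mul, zsmul_eq_mul]
    constructor
    · rintro ⟨y, rfl⟩
      exact ⟨y.val, by simp [mul_comm]⟩
    · rintro ⟨k, rfl⟩
      exact ⟨k, mul_comm _ _⟩
  have hk : Nat.card (nsmulAddMonoidHom (α := ZMod N) q).ker = torsionCard q (ZMod N) :=
    Nat.card_congr (Equiv.subtypeEquivRight fun x => by simp [AddMonoidHom.mem_ker])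
  rw [hr, hk, Nat.card_zmultiples, ZMod.addOrderOf_coe q (NeZero.ne N), Nat.card_zmod] at h
  have hpos : 0 < N / N.gcd q :=
    Nat.div_pos (Nat.gcd_le_left _ (NeZero.pos N)) (Nat.gcd_pos_of_pos_left _ (NeZero.pos N))
  refine Nat.eq_of_mul_eq_mul_right hpos ?_
  rw [h, Nat.mul_div_cancel' (Nat.gcd_dvd_left _ _)]

theorem torsionCard_zmod_prime_pow (p : ℕ) [Fact p.Prime] (m i : ℕ) :
    torsionCard (p ^ i) (ZMod (p ^ m)) = p ^ min i m := by
  have : NeZero (p ^ m) := ⟨pow_ne_zero _ (Fact.out : p.Prime).ne_zero⟩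
  rw [torsionCard_zmod]
  rcases le_total i m with h | h
  · rw [min_eq_left h, Nat.gcd_eq_right (pow_dvd_pow p h)]
  · rw [min_eq_right h, Nat.gcd_eq_left (pow_dvd_pow p h)]

theorem exists_addEquiv_pi_zmod_prime_pow (p N : ℕ) [Fact p.Prime] (A : Type*) [AddCommGroup A]
    [Finite A] (hA : ∀ x : A, p ^ N • x = 0) :
    ∃ (ι : Type) (_ : Fintype ι) (e : ι → ℕ),
      (∀ i, 0 < e i) ∧ Nonempty (A ≃+ ∀ i, ZMod (p ^ e i)) := by
  classical
  obtain ⟨ι, _, m, hm, ⟨f⟩⟩ := AddCommGroup.equiv_directSum_zmod_of_finite' A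
  let f' : A ≃+ ∀ i, ZMod (m i) := f.trans (DirectSum.addEquivProd _)
  have hd : ∀ i, ∃ e, 0 < e ∧ m i = p ^ e := by
    intro i
    have h : p ^ N • (Pi.single i 1 : ∀ i, ZMod (m i)) = 0 := by
      rw [← f'.apply_symm_apply (Pi.single i 1), ← map_nsmul, hA, map_zero]
    have h' := congrFun h i
    simp only [Pi.smul_apply, Pi.single_eq_same, nsmul_eq_mul, mul_one, Pi.zero_apply] at h'
    rw [ZMod.natCast_eq_zero_iff] at h'
    obtain ⟨e, -, he⟩ := (Nat.dvd_prime_pow Fact.out).1 h'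
    refine ⟨e, Nat.pos_of_ne_zero ?_, he⟩
    rintro rfl
    have := hm i
    simp [he] at this
  choose e he hme using hd
  obtain rfl : m = fun i => p ^ e i := funext hme
  exact ⟨ι, inferInstance, e, he, ⟨f'⟩⟩

theorem sum_min_succ {ι : Type*} [Fintype ι] (e : ι → ℕ) (j : ℕ) :
    ∑ i, min (j + 1) (e i) = ∑ i, min j (e i) + Fintype.card {i // j < e i} := by
  rw [Fintype.card_subtype, Finset.card_filter, ← Finset.sum_add_distrib]
  refine Finset.sum_congr rfl fun i _ => ?_
  split_ifs <;> omega

theorem card_lt_eq_card_eq_add_card_lt {ι : Type*} [Fintype ι] (e : ι → ℕ) (j : ℕ) :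
    Fintype.card {i // j < e i} =
      Fintype.card {i // e i = j + 1} + Fintype.card {i // j + 1 < e i} := by
  simp only [Fintype.card_subtype, Finset.card_filter, ← Finset.sum_add_distrib]
  refine Finset.sum_congr rfl fun i _ => ?_
  split_ifs <;> omega

/-- The first difference of j ↦ ∑ min(j, e_i) counts the i with e_i > j, so the second difference
counts, up to sign, those with e_i = j + 1. Zero exponents are invisible to these sums, hence the
positivity assumptions. -/
theorem exists_equiv_of_sum_min_eq {ι κ : Type*} [Fintype ι] [Fintype κ] {e : ι → ℕ} {e' : κ → ℕ}
    (he : ∀ i, 0 < e i) (he' : ∀ i, 0 < e' i)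
    (h : ∀ j, ∑ i, min j (e i) = ∑ i, min j (e' i)) :
    ∃ σ : ι ≃ κ, ∀ i, e' (σ i) = e i := by
  classical
  have hfib : ∀ j, Nonempty ({i // e i = j} ≃ {i // e' i = j}) := by
    intro j
    rcases j with - | j
    · have : IsEmpty {i // e i = 0} := ⟨fun x => (he x.1).ne' x.2⟩
      have : IsEmpty {i // e' i = 0} := ⟨fun x => (he' x.1).ne' x.2⟩
      exact ⟨Equiv.equivOfIsEmpty _ _⟩
    · rw [← Fintype.card_eq]
      have h0 := h j
      have h1 := h (j + 1)
      have h2 := h (j + 1 + 1)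
      rw [sum_min_succ, sum_min_succ] at h1
      rw [sum_min_succ, sum_min_succ, sum_min_succ, sum_min_succ] at h2
      have k1 := card_lt_eq_card_eq_add_card_lt e j
      have k2 := card_lt_eq_card_eq_add_card_lt e' j
      omega
  exact ⟨Equiv.ofFiberEquiv fun j => (hfib j).some, fun i => Equiv.ofFiberEquiv_map _ i⟩

/-- Finite abelian groups of `p`-power exponent are classified by the sizes of their
`p ^ i`-torsion subgroups. -/
theorem nonempty_addEquiv_of_torsionCard_eq (p N : ℕ) [Fact p.Prime] {A B : Type*}
    [AddCommGroup A] [AddCommGroup B] [Finite A] [Finite B]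
    (hA : ∀ x : A, p ^ N • x = 0) (hB : ∀ x : B, p ^ N • x = 0)
    (h : ∀ i, torsionCard (p ^ i) A = torsionCard (p ^ i) B) : Nonempty (A ≃+ B) := by
  obtain ⟨ι, _, e, he, ⟨f⟩⟩ := exists_addEquiv_pi_zmod_prime_pow p N A hA
  obtain ⟨κ, _, e', he', ⟨f'⟩⟩ := exists_addEquiv_pi_zmod_prime_pow p N B hB
  have hs : ∀ j, ∑ i, min j (e i) = ∑ i, min j (e' i) := by
    intro j
    have := h j
    rw [torsionCard_congr _ f, torsionCard_congr _ f', torsionCard_pi, torsionCard_pi] at this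
    simp only [torsionCard_zmod_prime_pow, Finset.prod_pow_eq_pow_sum] at this
    exact Nat.pow_right_injective (Fact.out : p.Prime).two_le this
  obtain ⟨σ, hσ⟩ := exists_equiv_of_sum_min_eq he he' hs
  obtain rfl : e = fun i => e' (σ i) := funext fun i => (hσ i).symm
  exact ⟨f.trans ((RingEquiv.piCongrLeft (fun i => ZMod (p ^ e' i)) σ).toAddEquiv.trans f'.symm)⟩

/-! ### Lagrangian subgroups and their enumeration by torsion sizes. -/

/-- The free symplectic module `(ℤ/N)^{2g}`. -/
abbrev SympV (g N : ℕ) : Type := (Fin g → ZMod N) × (Fin g → ZMod N)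

namespace SympV

variable {g N : ℕ}

/-- The standard alternating form on `(ℤ/N)^{2g}`. -/
def form (x y : SympV g N) : ZMod N := ∑ i, (x.1 i * y.2 i - x.2 i * y.1 i)

theorem form_add_left (x y z : SympV g N) : form (x + y) z = form x z + form y z := by
  simp only [form, ← Finset.sum_add_distrib, Prod.fst_add, Prod.snd_add, Pi.add_apply]
  exact Finset.sum_congr rfl fun i _ => by ring

theorem form_add_right (x y z : SympV g N) : form x (y + z) = form x y + form x z := by
  simp only [form, ← Finset.sum_add_distrib, Prod.fst_add, Prod.snd_add, Pi.add_apply]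
  exact Finset.sum_congr rfl fun i _ => by ring

theorem form_smul_left (c : ZMod N) (x y : SympV g N) : form (c • x) y = c * form x y := by
  simp only [form, Finset.mul_sum, Prod.smul_fst, Prod.smul_snd, Pi.smul_apply, smul_eq_mul]
  exact Finset.sum_congr rfl fun i _ => by ring

theorem form_smul_right (c : ZMod N) (x y : SympV g N) : form x (c • y) = c * form x y := by
  simp only [form, Finset.mul_sum, Prod.smul_fst, Prod.smul_snd, Pi.smul_apply, smul_eq_mul]
  exact Finset.sum_congr rfl fun i _ => by ring

theorem form_self (x : SympV g N) : form x x = 0 :=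
  Finset.sum_eq_zero fun i _ => by ring

theorem form_swap (x y : SympV g N) : form x y = -form y x := by
  simp only [form, ← Finset.sum_neg_distrib]
  exact Finset.sum_congr rfl fun i _ => by ring

theorem form_zero_left (y : SympV g N) : form 0 y = 0 := by
  simp [form]

theorem form_nsmul_left (k : ℕ) (x y : SympV g N) : form (k • x) y = k • form x y := by
  rw [← Nat.cast_smul_eq_nsmul (ZMod N), form_smul_left, nsmul_eq_mul]

theorem form_nsmul_right (k : ℕ) (x y : SympV g N) : form x (k • y) = k • form x y := by
  rw [← Nat.cast_smul_eq_nsmul (ZMod N), form_smul_right, nsmul_eq_mul]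

theorem form_zsmul_left (k : ℤ) (x y : SympV g N) : form (k • x) y = k • form x y := by
  rw [← Int.cast_smul_eq_zsmul (ZMod N), form_smul_left, zsmul_eq_mul]

theorem form_zsmul_right (k : ℤ) (x y : SympV g N) : form x (k • y) = k • form x y := by
  rw [← Int.cast_smul_eq_zsmul (ZMod N), form_smul_right, zsmul_eq_mul]

theorem form_snd_single (x : SympV g N) (i : Fin g) (c : ZMod N) :
    form x (0, Pi.single i c) = x.1 i * c := by
  rw [form, Finset.sum_eq_single i] <;> simp +contextual

theorem form_fst_single (x : SympV g N) (i : Fin g) (c : ZMod N) :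
    form x (Pi.single i c, 0) = -(x.2 i * c) := by
  rw [form, Finset.sum_eq_single i] <;> simp +contextual

/-- Subgroups of `(ℤ/N)^{2g}` that are their own orthogonal complement. -/
def IsLagrangian (H : AddSubgroup (SympV g N)) : Prop :=
  ∀ x, x ∈ H ↔ ∀ y ∈ H, form x y = 0

theorem sympForm_eq_one_iff [NeZero N] (x y : SympV g N) :
    sympForm (fun _ : Fin g => N) x y = 1 ↔ form x y = 0 := by
  have h : sympForm (fun _ : Fin g => N) x y = ZMod.stdAddChar (form x y) := by
    exact (map_prod (ZMod.stdAddChar (N := N)).toMonoidHom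
      (fun i => Multiplicative.ofAdd (x.1 i * y.2 i - x.2 i * y.1 i)) Finset.univ).symm
  rw [h, ← (ZMod.stdAddChar (N := N)).map_zero_eq_one, ZMod.injective_stdAddChar.eq_iff]

/-- If x is orthogonal to an isotropic H, then H + ⟨x⟩ is isotropic because the form is alternating;
maximality therefore puts x in H. -/
theorem isMaximalIsotropic_iff [NeZero N] (H : AddSubgroup (SympV g N)) :
    IsMaximalIsotropic (fun _ : Fin g => N) H ↔ IsLagrangian H := by
  have hiso : ∀ H : AddSubgroup (SympV g N), IsIsotropicSubgroup (fun _ : Fin g => N) H ↔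
      ∀ x ∈ H, ∀ y ∈ H, form x y = 0 := fun H =>
    forall₂_congr fun x _ => forall₂_congr fun y _ => sympForm_eq_one_iff x y
  constructor
  · intro h x
    have hH := (hiso H).1 h.1
    refine ⟨hH x, fun hx => ?_⟩
    refine h.2 (y := H ⊔ AddSubgroup.zmultiples x) ((hiso _).2 ?_) le_sup_left
      (AddSubgroup.mem_sup_right (AddSubgroup.mem_zmultiples x))
    intro u hu v hv
    obtain ⟨a, ha, _, ⟨k, rfl⟩, rfl⟩ := AddSubgroup.mem_sup.1 hu
    obtain ⟨b, hb, _, ⟨l, rfl⟩, rfl⟩ := AddSubgroup.mem_sup.1 hv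
    simp only [form_add_left, form_add_right, form_zsmul_left, form_zsmul_right, form_self,
      hH a ha b hb, hx b hb, form_swap a x, hx a ha]
    simp
  · intro h
    refine ⟨(hiso H).2 fun x hx => (h x).1 hx, fun M hM hHM x hx => (h x).2 fun y hy => ?_⟩
    exact (hiso M).1 hM x hx y (hHM hy)

theorem torsionCard_addSubgroup {A : Type*} [AddCommGroup A] (q : ℕ) (H : AddSubgroup A) :
    torsionCard q H = Nat.card (H ⊓ (nsmulAddMonoidHom (α := A) q).ker : AddSubgroup A) :=
  Nat.card_congr
    ⟨fun x => ⟨x.1.1, x.1.2, by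
        exact AddMonoidHom.mem_ker.2 (congrArg Subtype.val x.2)⟩,
      fun x => ⟨⟨x.1, x.2.1⟩, by
        exact Subtype.ext (AddMonoidHom.mem_ker.1 x.2.2)⟩, fun _ => rfl, fun _ => rfl⟩

theorem card_ker_nsmul {A : Type*} [AddCommGroup A] (q : ℕ) :
    Nat.card (nsmulAddMonoidHom (α := A) q).ker = torsionCard q A :=
  Nat.card_congr (Equiv.subtypeEquivRight fun x => by simp [AddMonoidHom.mem_ker])

theorem torsionCard_sympV (p : ℕ) [Fact p.Prime] (g n i : ℕ) :
    torsionCard (p ^ i) (SympV g (p ^ n)) = p ^ (min i n * (2 * g)) := by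
  rw [torsionCard_prod, torsionCard_pi]
  simp only [torsionCard_zmod_prime_pow, Finset.prod_const, Finset.card_univ, Fintype.card_fin]
  ring

theorem nsmul_eq_zero (x : SympV g N) : N • x = 0 := by
  ext i <;> simp

/-- The number of Lagrangian subgroups of `(ℤ/p^n)^{2g}` with `p ^ s i` elements killed by `p ^ i`,
for all `i`. -/
noncomputable def lagrangianCount (p g n : ℕ) (s : ℕ → ℕ) : ℕ :=
  Nat.card {H : AddSubgroup (SympV g (p ^ n)) //
    IsLagrangian H ∧ ∀ i, torsionCard (p ^ i) H = p ^ s i}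

theorem nuType_eq_lagrangianCount (p n : ℕ) [Fact p.Prime] (T : Type) [AddCommGroup T] [Finite T]
    (hT : ∀ x : T, p ^ n • x = 0) (s : ℕ → ℕ) (hs : ∀ i, torsionCard (p ^ i) T = p ^ s i) :
    nuType p n T = lagrangianCount p 2 n s := by
  refine Nat.card_congr (Equiv.subtypeEquivRight fun H => ?_)
  refine and_congr (isMaximalIsotropic_iff H) ⟨?_, fun h => ?_⟩
  · rintro ⟨f⟩ i
    rw [torsionCard_congr _ f, hs]
  · refine nonempty_addEquiv_of_torsionCard_eq p n (fun x => Subtype.ext ?_) hT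
      fun i => (h i).trans (hs i).symm
    exact nsmul_eq_zero (g := 2) (N := p ^ n) x.1

theorem lagrangianCount_of_subsingleton (p g n : ℕ) [Subsingleton (SympV g (p ^ n))] :
    lagrangianCount p g n (fun _ => 0) = 1 := by
  rw [lagrangianCount, Nat.card_eq_one_iff_unique]
  refine ⟨⟨fun a b => Subtype.ext (Subsingleton.elim _ _)⟩, ⟨⊥, fun x => ?_, fun i => ?_⟩⟩
  · rw [Subsingleton.elim x 0]
    exact ⟨fun _ y _ => form_zero_left y, fun _ => zero_mem _⟩
  · rw [pow_zero, torsionCard_eq_card fun x => Subsingleton.elim _ _]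
    exact Nat.card_unique

theorem lagrangianCount_exponent_zero (p g : ℕ) : lagrangianCount p g 0 (fun _ => 0) = 1 := by
  have : Subsingleton (ZMod (p ^ 0)) := by rw [pow_zero]; infer_instance
  exact lagrangianCount_of_subsingleton p g 0

theorem lagrangianCount_rank_zero (p n : ℕ) : lagrangianCount p 0 n (fun _ => 0) = 1 :=
  lagrangianCount_of_subsingleton p 0 n

end SympV

/-! ### Change of coefficients and peeling off the p-torsion. -/

theorem ZMod.nsmul_natCast_eq_zero_iff {N a b : ℕ} (hN : N = a * b) (ha : 0 < a) (v : ℕ) :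
    a • (v : ZMod N) = 0 ↔ b ∣ v := by
  rw [nsmul_eq_mul, ← Nat.cast_mul, ZMod.natCast_eq_zero_iff, hN, Nat.mul_dvd_mul_iff_left ha]

theorem ZMod.nsmul_eq_zero_iff_exists {N a b : ℕ} [NeZero N] (hN : N = a * b) (ha : 0 < a)
    (c : ZMod N) : a • c = 0 ↔ ∃ d, c = b • d := by
  constructor
  · intro h
    rw [← ZMod.natCast_zmod_val c, ZMod.nsmul_natCast_eq_zero_iff hN ha] at h
    obtain ⟨d, hd⟩ := h
    exact ⟨d, by rw [← ZMod.natCast_zmod_val c, hd, Nat.cast_mul, nsmul_eq_mul]⟩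
  · rintro ⟨d, rfl⟩
    rw [← mul_nsmul', ← hN, nsmul_eq_mul, ZMod.natCast_self, zero_mul]

theorem ZMod.castHom_eq_zero_iff {N a b : ℕ} [NeZero N] (hN : N = a * b) (ha : 0 < a)
    (hb : b ∣ N) (c : ZMod N) : ZMod.castHom hb (ZMod b) c = 0 ↔ a • c = 0 := by
  rw [← ZMod.natCast_zmod_val c, ZMod.nsmul_natCast_eq_zero_iff hN ha, map_natCast,
    ZMod.natCast_eq_zero_iff]

namespace SympV

variable {g : ℕ}

/-- Reduction of coefficients `(ℤ/N)^{2g} → (ℤ/M)^{2g}`. -/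
def reduce {M N : ℕ} (h : M ∣ N) : SympV g N →+ SympV g M :=
  ((ZMod.castHom h (ZMod M)).toAddMonoidHom.compLeft (Fin g)).prodMap
    ((ZMod.castHom h (ZMod M)).toAddMonoidHom.compLeft (Fin g))

theorem reduce_surjective {M N : ℕ} (h : M ∣ N) : Function.Surjective (reduce (g := g) h) := by
  intro x
  choose u hu using fun i => ZMod.castHom_surjective h (x.1 i)
  choose v hv using fun i => ZMod.castHom_surjective h (x.2 i)
  exact ⟨(u, v), Prod.ext (funext hu) (funext hv)⟩

theorem form_reduce {M N : ℕ} (h : M ∣ N) (x y : SympV g N) :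
    form (reduce h x) (reduce h y) = ZMod.castHom h (ZMod M) (form x y) := by
  simp only [form, map_sum, map_sub, map_mul]
  rfl

theorem reduce_eq_zero_iff {N a b : ℕ} [NeZero N] (hN : N = a * b) (ha : 0 < a)
    (hb : b ∣ N) (x : SympV g N) : reduce hb x = 0 ↔ a • x = 0 := by
  simp only [Prod.ext_iff, funext_iff]
  exact and_congr (forall_congr' fun i => ZMod.castHom_eq_zero_iff hN ha hb (x.1 i))
    (forall_congr' fun i => ZMod.castHom_eq_zero_iff hN ha hb (x.2 i))

theorem nsmul_eq_zero_iff_exists {N a b : ℕ} [NeZero N] (hN : N = a * b) (ha : 0 < a)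
    (x : SympV g N) : a • x = 0 ↔ ∃ z, x = b • z := by
  constructor
  · intro h
    choose u hu using fun i => (ZMod.nsmul_eq_zero_iff_exists hN ha (x.1 i)).1
      (congrFun (congrArg Prod.fst h) i)
    choose v hv using fun i => (ZMod.nsmul_eq_zero_iff_exists hN ha (x.2 i)).1
      (congrFun (congrArg Prod.snd h) i)
    exact ⟨(u, v), Prod.ext (funext hu) (funext hv)⟩
  · rintro ⟨z, rfl⟩
    rw [← mul_nsmul', ← hN, nsmul_eq_zero]

/-- The orthogonal complement of the `a`-torsion consists of multiples of `a`. -/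
theorem exists_eq_nsmul_of_forall_form_eq_zero {N a b : ℕ} [NeZero N] (hN : N = a * b)
    (hb : 0 < b) {x : SympV g N} (h : ∀ w, a • w = 0 → form x w = 0) : ∃ z, x = a • z := by
  rw [← nsmul_eq_zero_iff_exists (hN.trans (mul_comm a b)) hb]
  have hab : (a : ZMod N) * (b : ZMod N) = 0 := by
    rw [← Nat.cast_mul, ← hN, ZMod.natCast_self]
  ext i
  -- Pairing with `b` times a basis vector, which is `a`-torsion, shows that `b` kills the
  -- corresponding coordinate of `x`.
  · have := h (0, Pi.single i (b : ZMod N)) (by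
      ext j
      · simp
      · by_cases hj : j = i
        · subst hj; simpa using hab
        · simp [hj])
    rw [form_snd_single] at this
    simpa [mul_comm] using this
  · have := h (Pi.single i (b : ZMod N), 0) (by
      ext j
      · by_cases hj : j = i
        · subst hj; simpa using hab
        · simp [hj]
      · simp)
    rw [form_fst_single] at this
    simpa [mul_comm] using this

section Peel

variable {N M a : ℕ}

theorem form_nsmul_nsmul_eq_zero_iff [NeZero N] (hN : N = a * a * M) (ha : 0 < a) (hM : M ∣ N)
    (x y : SympV g N) : form (a • x) (a • y) = 0 ↔ form (reduce hM x) (reduce hM y) = 0 := by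
  rw [form_reduce, ZMod.castHom_eq_zero_iff hN (by positivity), form_nsmul_left, form_nsmul_right,
    mul_nsmul']

/-- On multiples of `a` the form is `a * a` times the form of the quotients, so it vanishes mod `N`
exactly when the reduced form vanishes mod `M`. Orthogonality thus transfers between `H` and `H'`.
-/
theorem isLagrangian_of_comap_eq [NeZero N] (hN : N = a * a * M) (ha : 0 < a) (hM : M ∣ N)
    {H : AddSubgroup (SympV g N)} {H' : AddSubgroup (SympV g M)}
    (hH : ∀ x ∈ H, ∃ z, x = a • z) (h : ∀ z, a • z ∈ H ↔ reduce hM z ∈ H') :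
    IsLagrangian H ↔ IsLagrangian H' := by
  have key : ∀ z, (∀ y ∈ H, form (a • z) y = 0) ↔ ∀ y ∈ H', form (reduce hM z) y = 0 := by
    intro z
    constructor
    · intro hz y hy
      obtain ⟨w, rfl⟩ := reduce_surjective hM y
      exact (form_nsmul_nsmul_eq_zero_iff hN ha hM z w).1 (hz _ ((h w).2 hy))
    · intro hz y hy
      obtain ⟨w, rfl⟩ := hH y hy
      exact (form_nsmul_nsmul_eq_zero_iff hN ha hM z w).2 (hz _ ((h w).1 hy))
  constructor
  · intro hL x
    obtain ⟨z, rfl⟩ := reduce_surjective hM x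
    rw [← h, hL, key]
  · intro hL x
    have hx : ∀ z, a • z ∈ H ↔ ∀ y ∈ H, form (a • z) y = 0 := fun z => by
      rw [h, hL, key]
    refine ⟨fun hxH => ?_, fun hxH => ?_⟩
    · obtain ⟨z, rfl⟩ := hH x hxH
      exact (hx z).1 hxH
    · have hMpos : 0 < M := Nat.pos_of_dvd_of_pos hM (NeZero.pos N)
      -- The `a`-torsion consists of elements `a • (M • z)`, which lie in `H` because `M • z`
      -- reduces to 0. Hence anything orthogonal to `H` is a multiple of `a`.
      obtain ⟨z, rfl⟩ := exists_eq_nsmul_of_forall_form_eq_zero (a := a) (b := a * M)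
        (by rw [hN, mul_assoc]) (by positivity) (x := x) (fun w hw => hxH w (by
          obtain ⟨z, rfl⟩ := (nsmul_eq_zero_iff_exists (b := a * M)
            (by rw [hN, mul_assoc]) ha w).1 hw
          rw [mul_nsmul', h, map_nsmul, nsmul_eq_zero]
          exact zero_mem _))
      exact (hx z).2 hxH

/-- Both sides count the z with `a • z` in `H` and killed by `b * a`: once along multiplication by
`a`, and once along reduction mod `M`, whose kernel is the `a * a`-torsion. -/
theorem torsionCard_of_comap_eq [NeZero N] (hN : N = a * a * M) (ha : 0 < a) (hM : M ∣ N)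
    {H : AddSubgroup (SympV g N)} {H' : AddSubgroup (SympV g M)}
    (hH : ∀ x ∈ H, ∃ z, x = a • z) (h : ∀ z, a • z ∈ H ↔ reduce hM z ∈ H') (b : ℕ) :
    torsionCard a (SympV g N) * torsionCard (b * a) H =
      torsionCard (a * a) (SympV g N) * torsionCard b H' := by
  have e1 := (nsmulAddMonoidHom (α := SympV g N) a).card_comap_of_le_range
    (S := H ⊓ (nsmulAddMonoidHom (b * a)).ker) (fun x hx => by
      obtain ⟨z, rfl⟩ := hH x hx.1
      exact ⟨z, rfl⟩)
  have e2 := (reduce (g := g) hM).card_comap_of_le_range (S := H' ⊓ (nsmulAddMonoidHom b).ker)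
    (fun x _ => reduce_surjective hM x)
  have hker : (reduce (g := g) hM).ker = (nsmulAddMonoidHom (a * a)).ker := by
    ext z
    rw [AddMonoidHom.mem_ker, AddMonoidHom.mem_ker, reduce_eq_zero_iff hN (by positivity)]
    rfl
  rw [card_ker_nsmul, ← torsionCard_addSubgroup] at e1
  rw [hker, card_ker_nsmul, ← torsionCard_addSubgroup] at e2
  rw [← e1, ← e2]
  congr 2
  ext z
  simp only [AddSubgroup.mem_comap, AddSubgroup.mem_inf, AddMonoidHom.mem_ker,
    nsmulAddMonoidHom_apply, h, ← map_nsmul]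
  rw [reduce_eq_zero_iff hN (by positivity), ← mul_nsmul', ← mul_nsmul',
    show b * a * a = a * a * b by ring]

end Peel

/-- Lagrangian subgroups containing the whole `p`-torsion correspond to Lagrangian subgroups over
`ℤ/p^n` instead of `ℤ/p^(n+2)`. -/
theorem lagrangianCount_add_two (p g n : ℕ) [Fact p.Prime] {s s' : ℕ → ℕ} (h0 : s 0 = 0)
    (h0' : s' 0 = 0) (hs : ∀ i, s (i + 1) = 2 * g + s' i) :
    lagrangianCount p g (n + 2) s = lagrangianCount p g n s' := by
  have hp : 0 < p := (Fact.out : p.Prime).pos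
  have hN : p ^ (n + 2) = p * p * p ^ n := by ring
  have hN' : p ^ (n + 2) = p * (p * p ^ n) := by ring
  have hM : p ^ n ∣ p ^ (n + 2) := pow_dvd_pow _ (by omega)
  let V := SympV g (p ^ (n + 2))
  let P : V →+ V := nsmulAddMonoidHom p
  let C : V →+ SympV g (p ^ n) := reduce hM
  have hkerC : ∀ z : V, C z = 0 ↔ p • (p • z) = 0 := fun z => by
    rw [← mul_nsmul']
    exact reduce_eq_zero_iff hN (by positivity) hM z
  have htors : ∀ {H : AddSubgroup V} {H' : AddSubgroup (SympV g (p ^ n))},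
      (∀ x ∈ H, ∃ z, x = p • z) → (∀ z, p • z ∈ H ↔ C z ∈ H') →
      ((∀ i, torsionCard (p ^ i) H = p ^ s i) ↔ ∀ i, torsionCard (p ^ i) H' = p ^ s' i) := by
    intro H H' hH h
    have key : ∀ i, torsionCard (p ^ (i + 1)) H = p ^ (2 * g) * torsionCard (p ^ i) H' := by
      intro i
      have := torsionCard_of_comap_eq hN hp hM hH h (p ^ i)
      have e1 := torsionCard_sympV p g (n + 2) 1
      have e2 := torsionCard_sympV p g (n + 2) 2
      rw [pow_one] at e1
      rw [pow_two] at e2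
      rw [e1, e2, ← pow_succ, show min 1 (n + 2) * (2 * g) = 2 * g by simp,
        show min 2 (n + 2) * (2 * g) = 2 * g + 2 * g by simp; ring, pow_add p (2 * g), mul_assoc] at this
      exact Nat.eq_of_mul_eq_mul_left (by positivity) this
    constructor
    · intro hi i
      have := hi (i + 1)
      rw [key, hs, pow_add] at this
      exact Nat.eq_of_mul_eq_mul_left (by positivity) this
    · intro hi i
      rcases i with - | i
      · rw [h0, pow_zero, torsionCard_one]
      · rw [key, hs, pow_add, hi]
  -- Since s(1) = 2g, H has as many elements killed by p as V does. So V[p] ≤ H, and by duality H ≤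
  -- V[p]^⊥ = pV.
  have hdom : ∀ H : AddSubgroup V, IsLagrangian H → torsionCard (p ^ 1) H = p ^ s 1 →
      (∀ w, p • w = 0 → w ∈ H) ∧ ∀ x ∈ H, ∃ z, x = p • z := by
    intro H hL ht
    have hle : ∀ w, p • w = 0 → w ∈ H := by
      have e1 := torsionCard_sympV p g (n + 2) 1
      have e2 := hs 0
      rw [torsionCard_addSubgroup, e2, h0', pow_one] at ht
      rw [pow_one, ← card_ker_nsmul, show min 1 (n + 2) * (2 * g) = 2 * g + 0 by simp, ← ht] at e1
      have := AddSubgroup.eq_of_le_of_card_ge (inf_le_right (a := H)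
        (b := (nsmulAddMonoidHom (α := V) p).ker)) e1.le
      intro w hw
      have hw' : w ∈ (nsmulAddMonoidHom (α := V) p).ker := AddMonoidHom.mem_ker.2 hw
      rw [← this] at hw'
      exact hw'.1
    refine ⟨hle, fun x hx => ?_⟩
    exact exists_eq_nsmul_of_forall_form_eq_zero hN' (by positivity)
      fun w hw => (hL x).1 hx w (hle w hw)
  -- The two correspondences are inverse because ker C = V[p²] lies in the preimage P⁻¹(H), and
  -- conversely ker P = V[p] lies in ker C.
  have hto : ∀ H : AddSubgroup V, (∀ w, p • w = 0 → w ∈ H) →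
      ((H.comap P).map C).comap C = H.comap P := by
    intro H hH
    refine AddSubgroup.comap_map_eq_self fun z hz => ?_
    exact hH _ ((hkerC z).1 (AddMonoidHom.mem_ker.1 hz))
  have hinv : ∀ H' : AddSubgroup (SympV g (p ^ n)),
      ((H'.comap C).map P).comap P = H'.comap C := by
    intro H'
    refine AddSubgroup.comap_map_eq_self fun z hz => ?_
    have hz' : p • z = 0 := AddMonoidHom.mem_ker.1 hz
    have : C z = 0 := (hkerC z).2 (by rw [hz', smul_zero])
    rw [AddSubgroup.mem_comap, this]
    exact zero_mem _
  refine Nat.card_congr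
    ⟨fun H => ⟨(H.1.comap P).map C, ?_⟩, fun H' => ⟨(H'.1.comap C).map P, ?_⟩, ?_, ?_⟩
  · obtain ⟨h1, h2⟩ := hdom H.1 H.2.1 (H.2.2 1)
    have h3 : ∀ z, p • z ∈ H.1 ↔ C z ∈ (H.1.comap P).map C := fun z =>
      (SetLike.ext_iff.1 (hto H.1 h1) z).symm
    exact ⟨(isLagrangian_of_comap_eq hN hp hM h2 h3).1 H.2.1, (htors h2 h3).1 H.2.2⟩
  · have h2 : ∀ x ∈ (H'.1.comap C).map P, ∃ z, x = p • z := by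
      rintro _ ⟨z, -, rfl⟩
      exact ⟨z, rfl⟩
    have h3 : ∀ z, p • z ∈ (H'.1.comap C).map P ↔ C z ∈ H'.1 := fun z =>
      SetLike.ext_iff.1 (hinv H'.1) z
    exact ⟨(isLagrangian_of_comap_eq hN hp hM h2 h3).2 H'.2.1, (htors h2 h3).2 H'.2.2⟩
  · intro H
    obtain ⟨h1, h2⟩ := hdom H.1 H.2.1 (H.2.2 1)
    refine Subtype.ext ?_
    change (((H.1.comap P).map C).comap C).map P = H.1
    rw [hto H.1 h1]
    refine AddSubgroup.map_comap_eq_self fun x hx => ?_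
    obtain ⟨z, rfl⟩ := h2 x hx
    exact ⟨z, rfl⟩
  · intro H'
    refine Subtype.ext ?_
    change (((H'.1.comap C).map P).comap P).map C = H'.1
    rw [hinv H'.1]
    exact AddSubgroup.map_comap_eq_self_of_surjective (reduce_surjective hM) _

end SympV

/-! ### Transvections and transitivity on elements of maximal order. -/

theorem ZMod.isUnit_of_prime_pow_nsmul_ne_zero {p n : ℕ} [Fact p.Prime] {c : ZMod (p ^ (n + 1))}
    (h : p ^ n • c ≠ 0) : IsUnit c := by
  have hp : p.Prime := Fact.out
  rw [← ZMod.natCast_zmod_val c, ne_eq,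
    ZMod.nsmul_natCast_eq_zero_iff (pow_succ p n) (pow_pos hp.pos n)] at h
  rw [← ZMod.natCast_zmod_val c, ZMod.isUnit_iff_coprime]
  exact Nat.Coprime.pow_right _ ((Nat.Prime.coprime_iff_not_dvd hp).2 h).symm

namespace SympV

variable {g N : ℕ}

/-- The symplectic transvection `u ↦ u + c ⟨u, v⟩ v`. -/
def transvection (c : ZMod N) (v : SympV g N) : SympV g N ≃+ SympV g N where
  toFun u := u + (c * form u v) • v
  invFun u := u - (c * form u v) • v
  left_inv u := by
    simp [form_add_left, form_smul_left, form_self]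
  right_inv u := by
    simp only [sub_eq_add_neg, ← neg_smul, form_add_left, form_smul_left, form_self, mul_zero,
      add_zero]
    rw [neg_smul, neg_add_cancel_right]
  map_add' u w := by
    rw [form_add_left, mul_add, add_smul]
    abel

theorem transvection_apply (c : ZMod N) (v u : SympV g N) :
    transvection c v u = u + (c * form u v) • v := rfl

theorem form_transvection (c : ZMod N) (v u w : SympV g N) :
    form (transvection c v u) (transvection c v w) = form u w := by
  simp only [transvection_apply, form_add_left, form_add_right, form_smul_left, form_smul_right,
    form_self]
  rw [form_swap w v]
  ring

/-- Since ⟨x, y - x⟩ = ⟨x, y⟩, the transvection along y - x with coefficient ⟨x, y⟩⁻¹ adds exactly y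
- x to x. -/
theorem exists_isometry_of_isUnit_form {x y : SympV g N} (h : IsUnit (form x y)) :
    ∃ T : SympV g N ≃+ SympV g N, (∀ u w, form (T u) (T w) = form u w) ∧ T x = y := by
  obtain ⟨u, hu⟩ := h
  refine ⟨transvection (↑u⁻¹ : ZMod N) (y - x), form_transvection _ _, ?_⟩
  have : form x (y - x) = u := by
    rw [sub_eq_add_neg, form_add_right, ← neg_one_smul (ZMod N) x, form_smul_right, form_self, hu]
    simp
  rw [transvection_apply, this, Units.inv_mul, one_smul, add_sub_cancel]

theorem exists_nsmul_form_ne_zero {q : ℕ} {x : SympV g N} (hx : q • x ≠ 0) :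
    ∃ z, q • form x z ≠ 0 := by
  by_contra! h
  refine hx (Prod.ext (funext fun i => ?_) (funext fun i => ?_))
  · simpa [form_snd_single] using h (0, Pi.single i 1)
  · simpa [form_fst_single] using h (Pi.single i 1, 0)

/-- Choose z whose pairings with x and y are both units; then two transvections carry x to z and z
to y. -/
theorem exists_isometry {p n : ℕ} [Fact p.Prime] {x y : SympV g (p ^ (n + 1))}
    (hx : p ^ n • x ≠ 0) (hy : p ^ n • y ≠ 0) :
    ∃ T : SympV g (p ^ (n + 1)) ≃+ SympV g (p ^ (n + 1)),
      (∀ u w, form (T u) (T w) = form u w) ∧ T x = y := by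
  -- The bad z form two proper subgroups, one for x and one for y, and a group is not the union of
  -- two proper subgroups.
  have hz : ∃ z, p ^ n • form x z ≠ 0 ∧ p ^ n • form y z ≠ 0 := by
    obtain ⟨u, hu⟩ := exists_nsmul_form_ne_zero hx
    obtain ⟨v, hv⟩ := exists_nsmul_form_ne_zero hy
    by_cases hu' : p ^ n • form y u = 0
    · by_cases hv' : p ^ n • form x v = 0
      · refine ⟨u + v, ?_, ?_⟩
        · rwa [form_add_right, smul_add, hv', add_zero]
        · rwa [form_add_right, smul_add, hu', zero_add]
      · exact ⟨v, hv', hv⟩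
    · exact ⟨u, hu, hu'⟩
  obtain ⟨z, hxz, hyz⟩ := hz
  obtain ⟨S, hS, rfl⟩ := exists_isometry_of_isUnit_form (ZMod.isUnit_of_prime_pow_nsmul_ne_zero hxz)
  have hyz' : IsUnit (form (S x) y) := by
    rw [form_swap]
    exact (ZMod.isUnit_of_prime_pow_nsmul_ne_zero hyz).neg
  obtain ⟨T, hT, hTy⟩ := exists_isometry_of_isUnit_form hyz'
  exact ⟨S.trans T, fun u w => by simp [hT, hS], hTy⟩

theorem IsLagrangian.map {H : AddSubgroup (SympV g N)} (hH : IsLagrangian H)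
    (T : SympV g N ≃+ SympV g N) (hT : ∀ u w, form (T u) (T w) = form u w) :
    IsLagrangian (H.map T.toAddMonoidHom) := by
  intro x
  obtain ⟨x, rfl⟩ := T.surjective x
  have hmem : ∀ u, T u ∈ H.map T.toAddMonoidHom ↔ u ∈ H := fun u => by simp
  rw [hmem, hH]
  constructor
  · rintro h _ ⟨y, hy, rfl⟩
    exact (hT x y).trans (h y hy)
  · intro h y hy
    rw [← hT]
    exact h _ ((hmem y).2 hy)

/-- An isometry transports Lagrangians injectively and preserves their torsion. Only the inequality
is needed: it is used in both directions. -/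
theorem card_lagrangian_mem_le [NeZero N] {x y : SympV g N} (p : ℕ) (s : ℕ → ℕ)
    (h : ∃ T : SympV g N ≃+ SympV g N, (∀ u w, form (T u) (T w) = form u w) ∧ T x = y) :
    Nat.card {H : AddSubgroup (SympV g N) //
      (IsLagrangian H ∧ ∀ i, torsionCard (p ^ i) H = p ^ s i) ∧ x ∈ H} ≤
    Nat.card
      {H : AddSubgroup (SympV g N) //
        (IsLagrangian H ∧ ∀ i, torsionCard (p ^ i) H = p ^ s i) ∧ y ∈ H} := by
  obtain ⟨T, hT, rfl⟩ := h
  refine Nat.card_le_card_of_injective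
    (fun H => ⟨H.1.map T.toAddMonoidHom, ⟨H.2.1.1.map T hT, fun i => ?_⟩, ?_⟩) ?_
  · exact (torsionCard_congr _ (T.addSubgroupMap H.1)).symm.trans (H.2.1.2 i)
  · exact ⟨x, H.2.2, rfl⟩
  · intro H H' h
    exact Subtype.ext (AddSubgroup.map_injective T.injective (congrArg Subtype.val h))

/-! ### Lagrangians through a basis vector e, and the quotient e^⊥/⟨e⟩. -/

section Extend

/-- Forget the first hyperbolic plane. -/
def tail : SympV (g + 1) N →+ SympV g N where
  toFun x := (Fin.tail x.1, Fin.tail x.2)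
  map_zero' := rfl
  map_add' _ _ := rfl

/-- The inclusion of `(ℤ/N)^{2g}` as the complement of the first hyperbolic plane. -/
def consZero : SympV g N →+ SympV (g + 1) N where
  toFun x := (Fin.cons 0 x.1, Fin.cons 0 x.2)
  map_zero' := by
    ext i <;> refine Fin.cases ?_ (fun j => ?_) i <;> simp
  map_add' x y := by
    ext i <;> refine Fin.cases ?_ (fun j => ?_) i <;> simp

theorem tail_apply (x : SympV (g + 1) N) : tail x = (Fin.tail x.1, Fin.tail x.2) := rfl

theorem consZero_apply (x : SympV g N) :
    consZero x =
      ((Fin.cons 0 x.1 : Fin (g + 1) → ZMod N), (Fin.cons 0 x.2 : Fin (g + 1) → ZMod N)) := rfl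

theorem tail_consZero (x : SympV g N) : tail (consZero x) = x := by
  simp [tail_apply, consZero_apply]

theorem form_succ (x y : SympV (g + 1) N) :
    form x y = x.1 0 * y.2 0 - x.2 0 * y.1 0 + form (tail x) (tail y) := by
  rw [form, Fin.sum_univ_succ]
  rfl

/-- The first basis vector. -/
def basisZero : SympV (g + 1) N := (Pi.single 0 1, 0)

theorem tail_smul_basisZero (c : ZMod N) : tail (c • basisZero : SympV (g + 1) N) = 0 := by
  ext i <;> simp [tail_apply, basisZero, Fin.tail]

theorem form_smul_basisZero (x : SympV (g + 1) N) (c : ZMod N) :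
    form x (c • basisZero) = -(c * x.2 0) := by
  rw [form_smul_right, basisZero, form_fst_single]
  ring

theorem eq_smul_basisZero_add_consZero {x : SympV (g + 1) N} (hx : x.2 0 = 0) :
    x = x.1 0 • basisZero + consZero (tail x) := by
  ext i <;> refine Fin.cases ?_ (fun j => ?_) i <;> 
    simp [basisZero, consZero_apply, tail_apply, hx, Fin.tail]

/-- The sum of the line through the first basis vector and a subgroup of `(ℤ/N)^{2g}`. -/
def extend (H : AddSubgroup (SympV g N)) : AddSubgroup (SympV (g + 1) N) where
  carrier := {x | x.2 0 = 0 ∧ tail x ∈ H}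
  zero_mem' := ⟨rfl, by rw [map_zero]; exact H.zero_mem⟩
  add_mem' := fun hx hy =>
    ⟨by simp [hx.1, hy.1], by rw [map_add]; exact H.add_mem hx.2 hy.2⟩
  neg_mem' := fun hx => ⟨by simp [hx.1], by rw [map_neg]; exact H.neg_mem hx.2⟩

theorem mem_extend {H : AddSubgroup (SympV g N)} {x : SympV (g + 1) N} :
    x ∈ extend H ↔ x.2 0 = 0 ∧ tail x ∈ H := Iff.rfl

theorem smul_basisZero_mem_extend (H : AddSubgroup (SympV g N)) (c : ZMod N) :
    c • basisZero ∈ extend H :=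
  ⟨by simp [basisZero], by rw [tail_smul_basisZero]; exact H.zero_mem⟩

theorem consZero_mem_extend {H : AddSubgroup (SympV g N)} {x : SympV g N} :
    consZero x ∈ extend H ↔ x ∈ H := by
  rw [mem_extend, tail_consZero]
  simp [consZero_apply]

/-- `extend H` is the preimage in e^⊥ of `H`, viewed in e^⊥/⟨e⟩. Vectors `consZero x` test
orthogonality in the quotient, and e itself forces the coordinate `x.2 0` to vanish. -/
theorem isLagrangian_extend_iff {H : AddSubgroup (SympV g N)} :
    IsLagrangian (extend H) ↔ IsLagrangian H := by
  have hform : ∀ (x : SympV g N) (y : SympV (g + 1) N), form (consZero x) y = form x (tail y) := by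
    intro x y
    rw [form_succ, tail_consZero]
    simp [consZero_apply]
  constructor
  · intro h x
    rw [← consZero_mem_extend, h]
    constructor
    · intro hx y hy
      have := hx _ (consZero_mem_extend.2 hy)
      rwa [hform, tail_consZero] at this
    · intro hx y hy
      rw [hform]
      exact hx _ hy.2
  · intro h x
    constructor
    · intro hx y hy
      rw [form_succ, hx.1, hy.1, (h _).1 hx.2 _ hy.2]
      ring
    · intro hx
      refine ⟨?_, (h _).2 fun y hy => ?_⟩
      · have := hx _ (smul_basisZero_mem_extend H 1)
        rw [form_smul_basisZero] at this
        simpa using this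
      · have := hx _ (consZero_mem_extend.2 hy)
        rwa [form_swap, hform, ← form_swap] at this

/-- The extended subgroup is a product. -/
def extendEquiv (H : AddSubgroup (SympV g N)) : extend H ≃+ ZMod N × H where
  toFun x := (x.1.1 0, ⟨tail x.1, x.2.2⟩)
  invFun y := ⟨y.1 • basisZero + consZero y.2.1,
    add_mem (smul_basisZero_mem_extend H y.1) (consZero_mem_extend.2 y.2.2)⟩
  left_inv x := Subtype.ext (eq_smul_basisZero_add_consZero x.2.1).symm
  right_inv y := by
    refine Prod.ext ?_ (Subtype.ext ?_)
    · simp [basisZero, consZero_apply]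
    · change tail (y.1 • basisZero + consZero y.2.1) = y.2.1
      rw [map_add, tail_smul_basisZero, tail_consZero, zero_add]
  map_add' _ _ := rfl

/-- A Lagrangian containing e contains the whole line of e and lies in e^⊥, so it is recovered from
its image in e^⊥/⟨e⟩. -/
theorem extend_comap_consZero {H : AddSubgroup (SympV (g + 1) N)} (hH : IsLagrangian H)
    (h : basisZero ∈ H) : extend (H.comap consZero) = H := by
  have hmem : ∀ c : ZMod N, c • basisZero ∈ H := by
    intro c
    refine (hH _).2 fun y hy => ?_
    rw [form_smul_left, (hH _).1 h y hy, mul_zero]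
  have hzero : ∀ x ∈ H, x.2 0 = 0 := by
    intro x hx
    have := (hH _).1 hx _ (hmem 1)
    rw [form_smul_basisZero] at this
    simpa using this
  ext x
  have key : x.2 0 = 0 → (consZero (tail x) ∈ H ↔ x ∈ H) := by
    intro hx
    conv_rhs => rw [eq_smul_basisZero_add_consZero hx]
    rw [AddSubgroup.add_mem_cancel_left _ (hmem _)]
  rw [mem_extend, AddSubgroup.mem_comap]
  exact ⟨fun hx => (key hx.1).1 hx.2, fun hx => ⟨hzero x hx, (key (hzero x hx)).2 hx⟩⟩

end Extend

/-! ### Double counting over elements of maximal order. -/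

theorem card_lagrangian_basisZero_mem (p g n : ℕ) [Fact p.Prime] {s s' : ℕ → ℕ}
    (hs : ∀ i, s i = min i n + s' i) :
    Nat.card {H : AddSubgroup (SympV (g + 1) (p ^ n)) //
      (IsLagrangian H ∧ ∀ i, torsionCard (p ^ i) H = p ^ s i) ∧ basisZero ∈ H} =
    lagrangianCount p g n s' := by
  have hp : p.Prime := Fact.out
  have htors : ∀ H : AddSubgroup (SympV g (p ^ n)),
      (∀ i, torsionCard (p ^ i) (extend H) = p ^ s i) ↔
        ∀ i, torsionCard (p ^ i) H = p ^ s' i := by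
    refine fun H => forall_congr' fun i => ?_
    rw [torsionCard_congr _ (extendEquiv H), torsionCard_prod, torsionCard_zmod_prime_pow, hs,
      pow_add]
    exact Nat.mul_right_inj (pow_pos hp.pos _).ne'
  refine Nat.card_congr
    ⟨fun H => ⟨H.1.comap consZero, ?_⟩, fun H => ⟨extend H.1, ?_⟩, fun H => ?_, fun H => ?_⟩
  · have he := extend_comap_consZero H.2.1.1 H.2.2
    refine ⟨?_, ?_⟩
    · rw [← isLagrangian_extend_iff, he]
      exact H.2.1.1
    · rw [← htors, he]
      exact H.2.1.2
  · refine ⟨⟨isLagrangian_extend_iff.2 H.2.1, (htors H.1).2 H.2.2⟩, ?_⟩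
    have := smul_basisZero_mem_extend H.1 1
    rwa [one_smul] at this
  · exact Subtype.ext (extend_comap_consZero H.2.1.1 H.2.2)
  · exact Subtype.ext (AddSubgroup.ext fun x => consZero_mem_extend)

theorem card_nsmul_ne_zero (q : ℕ) (A : Type*) [AddCommGroup A] [Finite A] :
    Nat.card {x : A // q • x ≠ 0} = Nat.card A - torsionCard q A := by
  classical
  have := Fintype.ofFinite A
  simp only [torsionCard, Nat.card_eq_fintype_card]
  exact Fintype.card_subtype_compl _

/-- Double counting of pairs of a Lagrangian subgroup and an element of maximal order in it. -/
theorem lagrangianCount_succ_mul (p g n : ℕ) [Fact p.Prime] {s s' : ℕ → ℕ}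
    (hs : ∀ i, s i = min i (n + 1) + s' i) :
    lagrangianCount p (g + 1) (n + 1) s * (p ^ s (n + 1) - p ^ s n) =
      (p ^ ((n + 1) * (2 * (g + 1))) - p ^ (n * (2 * (g + 1)))) *
        lagrangianCount p g (n + 1) s' := by
  classical
  have hp : p.Prime := Fact.out
  let V := SympV (g + 1) (p ^ (n + 1))
  let Q : AddSubgroup V → Prop := fun H => IsLagrangian H ∧ ∀ i, torsionCard (p ^ i) H = p ^ s i
  have hbasis : p ^ n • (basisZero : V) ≠ 0 := by
    intro h
    have := congrFun (congrArg Prod.fst h) 0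
    simp only [basisZero, Prod.smul_fst, Pi.smul_apply, Pi.single_eq_same, Prod.fst_zero,
      Pi.zero_apply] at this
    rw [← Nat.cast_one (R := ZMod (p ^ (n + 1))),
      ZMod.nsmul_natCast_eq_zero_iff (pow_succ p n) (pow_pos hp.pos n)] at this
    exact hp.one_lt.not_ge (Nat.le_of_dvd one_pos this)
  have hx : ∀ x : {x : V // p ^ n • x ≠ 0},
      Nat.card {H : {H // Q H} // x.1 ∈ H.1} = lagrangianCount p g (n + 1) s' := by
    intro x
    rw [← card_lagrangian_basisZero_mem p g (n + 1) hs,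
      Nat.card_congr (Equiv.subtypeSubtypeEquivSubtypeInter Q fun H => x.1 ∈ H)]
    have hle : ∀ {x y : V}, p ^ n • x ≠ 0 → p ^ n • y ≠ 0 →
        Nat.card {H // Q H ∧ x ∈ H} ≤ Nat.card {H // Q H ∧ y ∈ H} := by
      exact fun hx hy => card_lagrangian_mem_le p s (exists_isometry hx hy)
    exact le_antisymm (hle x.2 hbasis) (hle hbasis x.2)
  -- All of H is killed by p^(n+1), so p^s(n+1) is its order; removing the p^n-torsion leaves the
  -- elements of maximal order.
  have hH : ∀ H : {H // Q H}, Nat.card {x : {x : V // p ^ n • x ≠ 0} // x.1 ∈ H.1} =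
      p ^ s (n + 1) - p ^ s n := by
    intro H
    rw [← H.2.2 (n + 1), ← H.2.2 n, torsionCard_eq_card (q := p ^ (n + 1))
      fun x => Subtype.ext (nsmul_eq_zero x.1), ← card_nsmul_ne_zero]
    exact Nat.card_congr ⟨fun x => ⟨⟨x.1.1, x.2⟩, fun h => x.1.2 (congrArg Subtype.val h)⟩,
      fun x => ⟨⟨x.1.1, fun h => x.2 (Subtype.ext h)⟩, x.1.2⟩, fun _ => rfl, fun _ => rfl⟩
  have hU : Nat.card {x : V // p ^ n • x ≠ 0} =
      p ^ ((n + 1) * (2 * (g + 1))) - p ^ (n * (2 * (g + 1))) := by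
    have e := torsionCard_sympV p (g + 1) (n + 1) (n + 1)
    rw [torsionCard_eq_card nsmul_eq_zero, min_self] at e
    rw [card_nsmul_ne_zero, e, torsionCard_sympV, min_eq_left n.le_succ]
  have := Fintype.ofFinite {H // Q H}
  have := Fintype.ofFinite {x : V // p ^ n • x ≠ 0}
  have key : Nat.card (Σ H : {H // Q H}, {x : {x : V // p ^ n • x ≠ 0} // x.1 ∈ H.1}) =
      Nat.card (Σ x : {x : V // p ^ n • x ≠ 0}, {H : {H // Q H} // x.1 ∈ H.1}) :=
    Nat.card_congr ⟨fun a => ⟨a.2.1, a.1, a.2.2⟩, fun a => ⟨a.2.1, a.1, a.2.2⟩,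
      fun _ => rfl, fun _ => rfl⟩
  rw [Nat.card_sigma, Nat.card_sigma] at key
  simp only [hx, hH, Finset.sum_const, Finset.card_univ, ← Nat.card_eq_fintype_card, hU,
    smul_eq_mul] at key
  exact key

end SympV

/-! ### Explicit counts for g = 1 and g = 2. -/

namespace SympV

theorem nsmul_zmod_prime_pow_eq_zero (p : ℕ) {a n : ℕ} (h : a ≤ n) (x : ZMod (p ^ a)) :
    p ^ n • x = 0 := by
  rw [nsmul_eq_mul, (ZMod.natCast_eq_zero_iff _ _).2 (pow_dvd_pow p h), zero_mul]

variable (p : ℕ) [Fact p.Prime]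

/-- Peeling `l` times. Truncated subtraction together with s'(0) = 0 makes the second summand vanish
for i ≤ l, where all of V[p^i] lies in the subgroup. -/
theorem lagrangianCount_add_two_mul (g n l : ℕ) {s' : ℕ → ℕ} (h0 : s' 0 = 0) :
    lagrangianCount p g (n + 2 * l) (fun i => 2 * g * min i l + s' (i - l)) =
      lagrangianCount p g n s' := by
  induction l with
  | zero => simp
  | succ l ih =>
    rw [← ih]
    refine lagrangianCount_add_two p g (n + 2 * l) (by simp [h0]) (by simp [h0]) fun i => ?_
    rw [Nat.add_min_add_right, Nat.add_sub_add_right]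
    ring

theorem lagrangianCount_one_cyclic (m : ℕ) :
    lagrangianCount p 1 (m + 1) (fun i => min i (m + 1)) = p ^ m * (p + 1) := by
  have hp : p.Prime := Fact.out
  have h := lagrangianCount_succ_mul p 0 m (s := fun i => min i (m + 1)) (s' := fun _ => 0)
    fun i => by simp
  rw [lagrangianCount_rank_zero, min_self, min_eq_left m.le_succ] at h
  have hpos : 0 < p ^ (m + 1) - p ^ m :=
    Nat.sub_pos_of_lt (Nat.pow_lt_pow_right hp.one_lt m.lt_succ_self)
  refine Nat.eq_of_mul_eq_mul_right hpos (h.trans ?_)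
  have h1 := Nat.pow_le_pow_right hp.pos m.le_succ
  have h2 : p ^ (m * (2 * (0 + 1))) ≤ p ^ ((m + 1) * (2 * (0 + 1))) :=
    Nat.pow_le_pow_right hp.pos (by omega)
  zify [h1, h2]
  ring

theorem lagrangianCount_one (m k : ℕ) :
    lagrangianCount p 1 (m + 1 + 2 * k) (fun i => min i (m + 1 + k) + min i k) =
      p ^ m * (p + 1) := by
  rw [← lagrangianCount_one_cyclic, ← lagrangianCount_add_two_mul p 1 (m + 1) k (by simp)]
  congr 1
  funext i
  omega

theorem lagrangianCount_one_balanced (k : ℕ) :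
    lagrangianCount p 1 (2 * k) (fun i => min i k + min i k) = 1 := by
  have h := lagrangianCount_add_two_mul p 1 0 k (s' := fun _ => 0) rfl
  rw [lagrangianCount_exponent_zero, zero_add] at h
  rw [← h]
  congr 1
  funext i
  omega

theorem lagrangianCount_two_free (m : ℕ) :
    lagrangianCount p 2 (m + 1) (fun i => min i (m + 1) + min i (m + 1)) =
      p ^ (3 * m) * (p ^ 2 + 1) * (p + 1) := by
  have hp : p.Prime := Fact.out
  have h := lagrangianCount_succ_mul p 1 m (s := fun i => min i (m + 1) + min i (m + 1))
    (s' := fun i => min i (m + 1)) fun i => rfl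
  rw [lagrangianCount_one_cyclic, min_self, min_eq_left m.le_succ] at h
  have h1 : p ^ (m + m) < p ^ (m + 1 + (m + 1)) := Nat.pow_lt_pow_right hp.one_lt (by omega)
  refine Nat.eq_of_mul_eq_mul_right (Nat.sub_pos_of_lt h1) (h.trans ?_)
  have h2 : p ^ (m * (2 * (1 + 1))) ≤ p ^ ((m + 1) * (2 * (1 + 1))) :=
    Nat.pow_le_pow_right hp.pos (by omega)
  zify [h1.le, h2]
  ring

/-- Splitting gives the factor (p^{4n+4} - p^{4n}) / (p^{2n+2} - p^{2n+1}) = p^{2n-1}(p²+1)(p+1).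
The extra `p` on the left avoids the exponent 2n - 1. Positivity of `k` and `j` keeps both at most
n, so the subgroup has only one cyclic factor of full order. -/
theorem lagrangianCount_two_of_rank_three (n k j c : ℕ) (hn : k + j = n + 1) (hk : 0 < k)
    (hj : 0 < j) (hc : lagrangianCount p 1 (n + 1) (fun i => min i k + min i j) = c) :
    lagrangianCount p 2 (n + 1) (fun i => min i (n + 1) + (min i k + min i j)) * p =
      p ^ (2 * n) * (p ^ 2 + 1) * (p + 1) * c := by
  have hp : p.Prime := Fact.out
  have h := lagrangianCount_succ_mul p 1 n (s := fun i => min i (n + 1) + (min i k + min i j))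
    (s' := fun i => min i k + min i j) fun i => rfl
  rw [hc, show min (n + 1) (n + 1) + (min (n + 1) k + min (n + 1) j) = 2 * n + 2 by omega,
    show min n (n + 1) + (min n k + min n j) = 2 * n + 1 by omega] at h
  have h1 : p ^ (2 * n + 1) < p ^ (2 * n + 2) := Nat.pow_lt_pow_right hp.one_lt (by omega)
  have h2 : p ^ (n * (2 * (1 + 1))) ≤ p ^ ((n + 1) * (2 * (1 + 1))) :=
    Nat.pow_le_pow_right hp.pos (by omega)
  refine Nat.eq_of_mul_eq_mul_right (Nat.sub_pos_of_lt h1) ?_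
  rw [mul_right_comm, h]
  zify [h1.le, h2]
  ring

theorem lagrangianCount_two_unbalanced (m k : ℕ) :
    lagrangianCount p 2 (m + 1 + 2 * (k + 1))
        (fun i => min i (m + 1 + 2 * (k + 1)) + (min i (m + 1 + (k + 1)) + min i (k + 1))) =
      p ^ (3 * m + 4 * k + 3) * (p ^ 2 + 1) * (p + 1) ^ 2 := by
  have hp : p.Prime := Fact.out
  have h := lagrangianCount_two_of_rank_three p (m + 2 * k + 2) (m + 1 + (k + 1)) (k + 1) _
    (by omega) (by omega) (by omega)
    ((congrArg (lagrangianCount p 1 · _) (by omega)).trans (lagrangianCount_one p m (k + 1)))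
  rw [show m + 2 * k + 2 + 1 = m + 1 + 2 * (k + 1) by omega] at h
  refine Nat.eq_of_mul_eq_mul_right hp.pos (h.trans ?_)
  ring

theorem lagrangianCount_two_balanced (k : ℕ) :
    lagrangianCount p 2 (2 * (k + 1))
        (fun i => min i (2 * (k + 1)) + (min i (k + 1) + min i (k + 1))) =
      p ^ (4 * k + 1) * (p ^ 2 + 1) * (p + 1) := by
  have hp : p.Prime := Fact.out
  have h := lagrangianCount_two_of_rank_three p (2 * k + 1) (k + 1) (k + 1) _
    (by omega) (by omega) (by omega)
    ((congrArg (lagrangianCount p 1 · _) (by omega)).trans (lagrangianCount_one_balanced p (k + 1)))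
  rw [show 2 * k + 1 + 1 = 2 * (k + 1) by omega] at h
  refine Nat.eq_of_mul_eq_mul_right hp.pos (h.trans ?_)
  ring

/-! ### From isomorphism types to torsion data, and the seven cases. -/

theorem nuType_prod_two {n a b : ℕ} (ha : a ≤ n) (hb : b ≤ n) :
    nuType p n (ZMod (p ^ a) × ZMod (p ^ b)) =
      lagrangianCount p 2 n fun i => min i a + min i b := by
  refine nuType_eq_lagrangianCount p n _ (fun x => ?_) _ fun i => ?_
  · exact Prod.ext (nsmul_zmod_prime_pow_eq_zero p ha _) (nsmul_zmod_prime_pow_eq_zero p hb _)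
  · simp only [torsionCard_prod, torsionCard_zmod_prime_pow, pow_add]

theorem nuType_prod_three {n a b c : ℕ} (ha : a ≤ n) (hb : b ≤ n) (hc : c ≤ n) :
    nuType p n (ZMod (p ^ a) × ZMod (p ^ b) × ZMod (p ^ c)) =
      lagrangianCount p 2 n fun i => min i a + (min i b + min i c) := by
  refine nuType_eq_lagrangianCount p n _ (fun x => ?_) _ fun i => ?_
  · exact Prod.ext (nsmul_zmod_prime_pow_eq_zero p ha _)
      (Prod.ext (nsmul_zmod_prime_pow_eq_zero p hb _) (nsmul_zmod_prime_pow_eq_zero p hc _))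
  · simp only [torsionCard_prod, torsionCard_zmod_prime_pow, pow_add]

theorem nuType_prod_four {n a b c d : ℕ} (ha : a ≤ n) (hb : b ≤ n) (hc : c ≤ n) (hd : d ≤ n) :
    nuType p n (ZMod (p ^ a) × ZMod (p ^ b) × ZMod (p ^ c) × ZMod (p ^ d)) =
      lagrangianCount p 2 n fun i => min i a + (min i b + (min i c + min i d)) := by
  refine nuType_eq_lagrangianCount p n _ (fun x => ?_) _ fun i => ?_
  · exact Prod.ext (nsmul_zmod_prime_pow_eq_zero p ha _)
      (Prod.ext (nsmul_zmod_prime_pow_eq_zero p hb _)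
        (Prod.ext (nsmul_zmod_prime_pow_eq_zero p hc _) (nsmul_zmod_prime_pow_eq_zero p hd _)))
  · simp only [torsionCard_prod, torsionCard_zmod_prime_pow, pow_add]

/-- Removing the `p ^ l`-torsion from a group of rank four. -/
theorem lagrangianCount_two_reduce {n a b c l n' : ℕ} (hn : n = n' + 2 * l) (ha : l ≤ a)
    (hb : l ≤ b) (hc : l ≤ c) :
    lagrangianCount p 2 n (fun i => min i a + (min i b + (min i c + min i l))) =
      lagrangianCount p 2 n' fun i => min i (a - l) + (min i (b - l) + min i (c - l)) := by
  rw [← lagrangianCount_add_two_mul p 2 n' l (by simp), hn]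
  congr 1
  funext i
  omega

end SympV

open SympV

theorem proposition4p4 (p n : ℕ) [Fact p.Prime] (hn : 1 ≤ n) :
    -- type 1
    nuType p n (ZMod (p ^ n) × ZMod (p ^ n)) = p ^ (3 * n - 3) * (p ^ 2 + 1) * (p + 1) ∧
    -- type 2_k
    (∀ k : ℕ, 0 < k → k < n - k → n - k < n →
      nuType p n (ZMod (p ^ n) × ZMod (p ^ (n - k)) × ZMod (p ^ k)) =
        p ^ (3 * n - 2 * k - 4) * (p ^ 2 + 1) * (p + 1) ^ 2) ∧
    -- type 3
    (∀ k : ℕ, 2 * k = n →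
      nuType p n (ZMod (p ^ n) × ZMod (p ^ k) × ZMod (p ^ k)) =
        p ^ (2 * n - 3) * (p ^ 2 + 1) * (p + 1)) ∧
    -- type 4_{k,l}
    (∀ k l : ℕ, 0 < l → l < k → k < n - k →
      nuType p n (ZMod (p ^ (n - l)) × ZMod (p ^ (n - k)) × ZMod (p ^ k) × ZMod (p ^ l)) =
        p ^ (3 * n - 4 * l - 2 * k - 4) * (p ^ 2 + 1) * (p + 1) ^ 2) ∧
    -- type 5_l
    (∀ k l : ℕ, 0 < l → l < k → k < n → 2 * k = n →
      nuType p n (ZMod (p ^ (n - l)) × ZMod (p ^ k) × ZMod (p ^ k) × ZMod (p ^ l)) =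
        p ^ (2 * n - 4 * l - 3) * (p ^ 2 + 1) * (p + 1)) ∧
    -- type 6_k
    (∀ k : ℕ, 0 < k → k < n - k → n - k < n →
      nuType p n (ZMod (p ^ (n - k)) × ZMod (p ^ (n - k)) × ZMod (p ^ k) × ZMod (p ^ k)) =
        p ^ (3 * n - 6 * k - 3) * (p ^ 2 + 1) * (p + 1)) ∧
    -- type 7
    (∀ k : ℕ, 2 * k = n →
      nuType p n (ZMod (p ^ k) × ZMod (p ^ k) × ZMod (p ^ k) × ZMod (p ^ k)) = 1) := by
  refine ⟨?_, ?_, ?_, ?_, ?_, ?_, ?_⟩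
  · obtain ⟨m, rfl⟩ : ∃ m, n = m + 1 := ⟨n - 1, by omega⟩
    rw [nuType_prod_two p le_rfl le_rfl, lagrangianCount_two_free,
      show 3 * (m + 1) - 3 = 3 * m by omega]
  · intro k hk hkn _
    obtain ⟨k, rfl⟩ : ∃ j, k = j + 1 := ⟨k - 1, by omega⟩
    obtain ⟨m, rfl⟩ : ∃ m, n = m + 1 + 2 * (k + 1) := ⟨n - 2 * (k + 1) - 1, by omega⟩
    rw [nuType_prod_three p le_rfl (by omega) (by omega),
      show m + 1 + 2 * (k + 1) - (k + 1) = m + 1 + (k + 1) by omega,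
      lagrangianCount_two_unbalanced]
    congr 3
    omega
  · intro k hk
    -- Here k > 0 because 2k = n ≥ 1.
    obtain ⟨k, rfl⟩ : ∃ j, k = j + 1 := ⟨k - 1, by omega⟩
    subst hk
    rw [nuType_prod_three p le_rfl (by omega) (by omega), lagrangianCount_two_balanced]
    congr 3
    omega
  · intro k l hl hlk hkn
    obtain ⟨k, rfl⟩ : ∃ j, k = j + 1 + l := ⟨k - l - 1, by omega⟩
    obtain ⟨m, rfl⟩ : ∃ m, n = m + 1 + 2 * (k + 1) + 2 * l := ⟨n - 2 * (k + 1 + l) - 1, by omega⟩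
    rw [nuType_prod_four p (by omega) (by omega) (by omega) (by omega),
      lagrangianCount_two_reduce p rfl (by omega) (by omega) (by omega),
      show m + 1 + 2 * (k + 1) + 2 * l - l - l = m + 1 + 2 * (k + 1) by omega,
      show m + 1 + 2 * (k + 1) + 2 * l - (k + 1 + l) - l = m + 1 + (k + 1) by omega,
      show k + 1 + l - l = k + 1 by omega, lagrangianCount_two_unbalanced]
    congr 3
    omega
  · intro k l hl hlk hkn hk
    obtain ⟨k, rfl⟩ : ∃ j, k = j + 1 + l := ⟨k - l - 1, by omega⟩
    obtain rfl : n = 2 * (k + 1) + 2 * l := by omega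
    rw [nuType_prod_four p (by omega) (by omega) (by omega) (by omega),
      lagrangianCount_two_reduce p rfl (by omega) (by omega) (by omega),
      show 2 * (k + 1) + 2 * l - l - l = 2 * (k + 1) by omega,
      show k + 1 + l - l = k + 1 by omega, lagrangianCount_two_balanced]
    congr 3
    omega
  · intro k hk hkn _
    obtain ⟨m, rfl⟩ : ∃ m, n = m + 1 + 2 * k := ⟨n - 2 * k - 1, by omega⟩
    rw [nuType_prod_four p (by omega) (by omega) (by omega) (by omega),
      -- Peeling `k` times kills both smaller factors at once, leaving two free factors over
      -- ℤ/p^(m+1).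
      lagrangianCount_two_reduce p rfl (by omega) (by omega) (by omega),
      show m + 1 + 2 * k - k - k = m + 1 by omega, Nat.sub_self]
    simp only [Nat.min_zero, add_zero]
    rw [lagrangianCount_two_free]
    congr 3
    omega
  · intro k hk
    subst hk
    rw [nuType_prod_four p (by omega) (by omega) (by omega) (by omega),
      -- Peeling `k` times exhausts the exponent, leaving the unique Lagrangian of the trivial
      -- group.
      lagrangianCount_two_reduce p (zero_add _).symm le_rfl le_rfl le_rfl]
    simp only [Nat.sub_self, Nat.min_zero, add_zero]
    exact lagrangianCount_exponent_zero p 2
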